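/- For an element $s$ of a finite semigroup, let $s^\omega$ denote the unique idempotent among the powers $s^n$ ($n\ge 1$). Let $\mathsf V_2$ and $\mathsf V_3$ be the pseudovarieties of all finite semigroups $S$ such that, for all $t,x,z\in S$, with $e=t^\omega$ and $f=z^\omega$, one has $$\mathsf V_2:\quad exf(ef)^\omega=exf,\qquad\qquad \mathsf V_3:\quad (ef)^\omega exf=exf .$$ For a subsemigroup $U$ of a semigroup $T$, the dominion $\mathrm{Dom}(U,T)$ is the set of all $d\in T$ such that $\alpha(d)=\beta(d)$ for every semigroup $W$ (finite or infinite) and all semigroup morphisms $\alpha,\beta:T\to W$ that agree on $U$. A finite semigroup $S$ is F-saturated if $\mathrm{Dom}(S,T)\neq T$ for every finite semigroup $T$ that contains $S$ as a proper subsemigroup; a class of finite semigroups is F-saturated if all its members are. A class $\mathcal C$ of finite semigroups is F-epimorphically closed if, for every epimorphism $S\to T$ in the category of all semigroups with $S\in\mathcal C$ and $T$ finite, one has $T\in\mathcal C$. Then each of the pseudovarieties $\mathsf V_2$ and $\mathsf V_3$ is F-saturated and F-epimorphically closed. -/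

import Mathlib

universe u

namespace FSat

/-- `posPow s n` is the power `s ^ (n + 1)` in a semigroup. -/
def posPow {S : Type u} [Semigroup S] (s : S) : ℕ → S
  | 0 => s
  | n + 1 => posPow s n * s

theorem posPow_mul {S : Type u} [Semigroup S] (s : S) (m n : ℕ) :
    posPow s m * posPow s n = posPow s (m + n + 1) := by
  induction n with
  | zero => rfl
  | succ n ih =>
    change posPow s m * (posPow s n * s) = posPow s (m + n + 1) * s
    rw [← mul_assoc, ih]

/-- In a finite semigroup every element has exactly one idempotent among its positive powers. -/
theorem existsUnique_idempotent_posPow {S : Type u} [Semigroup S] [Finite S] (s : S) :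
    ∃! e : S, IsIdempotentElem e ∧ ∃ n : ℕ, e = posPow s n := by
  have huniq : ∀ e f : S, (IsIdempotentElem e ∧ ∃ n : ℕ, e = posPow s n) →
      (IsIdempotentElem f ∧ ∃ n : ℕ, f = posPow s n) → e = f := by
    rintro e f ⟨he, m, hm⟩ ⟨hf, n, hn⟩
    -- every positive power of an idempotent `g = s ^ (k + 1)` is `g`
    have key : ∀ (g : S) (k : ℕ), IsIdempotentElem g → g = posPow s k →
        ∀ j : ℕ, posPow s (j * (k + 1) + k) = g := by
      intro g k hg hk j
      induction j with
      | zero => simpa using hk.symm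
      | succ j ih =>
        have h := posPow_mul s (j * (k + 1) + k) k
        rw [ih, ← hk, hg.eq] at h
        rw [h]
        congr 1
        ring
    have h1 := key e m he hm n
    have h2 := key f n hf hn m
    rw [← h1, ← h2]
    congr 1
    ring
  have hex : ∃ e : S, IsIdempotentElem e ∧ ∃ n : ℕ, e = posPow s n := by
    obtain ⟨a, b, hab, h⟩ := Finite.exists_ne_map_eq_of_infinite (posPow s)
    wlog hlt : a < b generalizing a b
    · exact this b a hab.symm h.symm (by omega)
    obtain ⟨p, rfl⟩ : ∃ p, b = a + p + 1 := ⟨b - a - 1, by omega⟩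
    have step : ∀ c : ℕ, posPow s (a + c + (p + 1)) = posPow s (a + c) := by
      intro c
      induction c with
      | zero => exact h.symm
      | succ c ih =>
        have e1 : a + (c + 1) + (p + 1) = (a + c + (p + 1)) + 1 := by ring
        rw [e1]
        change posPow s (a + c + (p + 1)) * s = posPow s (a + c) * s
        rw [ih]
    have steps : ∀ j c : ℕ, posPow s (a + c + j * (p + 1)) = posPow s (a + c) := by
      intro j c
      induction j with
      | zero => simp
      | succ j ih =>
        have e1 : a + c + (j + 1) * (p + 1) = a + (c + j * (p + 1)) + (p + 1) := by ring
        have e2 : a + (c + j * (p + 1)) = a + c + j * (p + 1) := by ring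
        rw [e1, step, e2, ih]
    refine ⟨posPow s ((a + 1) * (p + 1) - 1), ?_, _, rfl⟩
    have hk : (a + 1) * (p + 1) = a + (a * p + p) + 1 := by ring
    change _ * _ = _
    rw [posPow_mul, hk]
    have e3 : a + (a * p + p) + 1 - 1 + (a + (a * p + p) + 1 - 1) + 1
        = a + (a * p + p) + (a + 1) * (p + 1) := by
      rw [hk]; omega
    rw [e3, steps]
    congr 1
  obtain ⟨e, he⟩ := hex
  exact ⟨e, he, fun f hf => huniq f e hf he⟩

/-- The `ω`-power of an element of a finite semigroup: its only idempotent positive power. -/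
noncomputable def omega {S : Type u} [Semigroup S] [Finite S] (s : S) : S :=
  (existsUnique_idempotent_posPow s).choose

/-- The dominion of a subsemigroup `U` of `S`; the two morphisms range over all pairs of
semigroup morphisms from `S` into a common, arbitrary (possibly infinite) semigroup. -/
def dominion {S : Type u} [Semigroup S] (U : Subsemigroup S) : Set S :=
  {d | ∀ (T : Type u) [Semigroup T] (α β : S →ₙ* T),
    (∀ x ∈ U, α x = β x) → α d = β d}

/-- A semigroup is F-saturated if it is not epimorphically embedded as a proper subsemigroup
in any finite semigroup. -/
def FSaturated (S : Type u) [Semigroup S] : Prop :=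
  ∀ (T : Type u) [Semigroup T] [Finite T] (ι : S →ₙ* T),
    Function.Injective ι → ¬ Function.Surjective ι → dominion ι.srange ≠ Set.univ

/-- A class of semigroups is F-saturated if all its members are. -/
def FSaturatedClass (C : CategoryTheory.ObjectProperty Semigrp.{u}) : Prop :=
  ∀ S : Semigrp.{u}, C S → FSaturated S

/-- A class of finite semigroups is F-epimorphically closed if it contains every finite
semigroup that is the codomain of an epimorphism (in the category of all semigroups) from a
member of the class. -/
def FEpiClosed (C : CategoryTheory.ObjectProperty Semigrp.{u}) : Prop :=
  ∀ (S T : Semigrp.{u}) (φ : S ⟶ T), Finite T → CategoryTheory.Epi φ → C S → C T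

/-- The finite semigroups satisfying `e x f (e f)^ω = e x f`, where `e = t^ω`, `f = z^ω`. -/
def V₂ : CategoryTheory.ObjectProperty Semigrp.{u} := fun S =>
  ∃ _ : Finite S, ∀ t x z : S,
    omega t * x * omega z * omega (omega t * omega z) = omega t * x * omega z

/-- The finite semigroups satisfying `(e f)^ω e x f = e x f`, where `e = t^ω`, `f = z^ω`. -/
def V₃ : CategoryTheory.ObjectProperty Semigrp.{u} := fun S =>
  ∃ _ : Finite S, ∀ t x z : S,
    omega (omega t * omega z) * omega t * x * omega z = omega t * x * omega z

end FSat

/-!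
Let `U` be a proper subsemigroup of a finite semigroup `T` with `Dom(U, T) = T`, and let `d ∉ U`
generate a maximal principal ideal among the elements outside `U`. A relation `P` on `T¹` such that
`P (a s) b ↔ P a (s b)` for all `s ∈ U` satisfies `P d 1 ↔ P 1 d`. For the relation
`a b = d ∧ b ∈ U¹` and its dual this gives factorizations `d = x u y` with `u ∈ U` and `x, y ∉ U`,
once with `u y ∈ U` and once with `x u ∈ U`. By maximality `x` and `y` are `𝓙`-equivalent to `d`,
so the factorizations can be iterated; as `T` is finite, this leads to idempotents `e, f ∈ U` in
the ideal of `d` and to `d = x u y` with `x = x f`, `u = f u e`, `y = e y ∉ U` and `u y ∈ U`. The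
laws of `V₂` and `V₃` both put `u` into the ideal of `(f e)^ω`. By stability all these elements are
then `𝓙`-equivalent and `u` is a unit of the local monoid at `(f e)^ω`, whence `y = e u^ω y ∈ U`, a
contradiction.
-/

namespace FSat

section Omega

variable {S T : Type u} [Semigroup S] [Semigroup T]

theorem posPow_succ' (s : S) (n : ℕ) : posPow s (n + 1) = s * posPow s n := by
  simpa only [posPow, zero_add] using (posPow_mul s 0 n).symm

theorem posPow_mem {U : Subsemigroup S} {s : S} (hs : s ∈ U) (n : ℕ) : posPow s n ∈ U := by
  induction n with
  | zero => exact hs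
  | succ n ih => exact mul_mem ih hs

theorem map_posPow (φ : S →ₙ* T) (s : S) (n : ℕ) : φ (posPow s n) = posPow (φ s) n := by
  induction n with
  | zero => rfl
  | succ n ih => rw [posPow, map_mul, ih, posPow]

theorem posPow_smul_eq_self {X : Type*} [SemigroupAction S X] {s : S} {x : X} (h : s • x = x)
    (n : ℕ) : posPow s n • x = x := by
  induction n with
  | zero => exact h
  | succ n ih => rw [posPow, mul_smul, h, ih]

theorem posPow_mul_mul_posPow_eq_self {a b x : S} (h : a * x * b = x) (n : ℕ) :
    posPow a n * x * posPow b n = x := by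
  induction n with
  | zero => exact h
  | succ n ih =>
    calc posPow a (n + 1) * x * posPow b (n + 1)
      _ = posPow a n * (a * x * b) * posPow b n := by
        rw [posPow, posPow_succ']; simp only [mul_assoc]
      _ = x := by rw [h, ih]

variable [Finite S] [Finite T]

theorem isIdempotentElem_omega (s : S) : IsIdempotentElem (omega s) :=
  (existsUnique_idempotent_posPow s).choose_spec.1.1

theorem exists_omega_eq_posPow (s : S) : ∃ n : ℕ, omega s = posPow s n :=
  (existsUnique_idempotent_posPow s).choose_spec.1.2

theorem eq_omega {s e : S} (he : IsIdempotentElem e) (hn : ∃ n : ℕ, e = posPow s n) :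
    e = omega s :=
  (existsUnique_idempotent_posPow s).choose_spec.2 e ⟨he, hn⟩

theorem omega_eq_self {e : S} (he : IsIdempotentElem e) : omega e = e :=
  (eq_omega he ⟨0, rfl⟩).symm

theorem map_omega (φ : S →ₙ* T) (s : S) : φ (omega s) = omega (φ s) := by
  obtain ⟨n, hn⟩ := exists_omega_eq_posPow s
  exact eq_omega ((isIdempotentElem_omega s).map φ) ⟨n, by rw [hn, map_posPow]⟩

theorem omega_mem {U : Subsemigroup S} {s : S} (hs : s ∈ U) : omega s ∈ U := by
  obtain ⟨n, hn⟩ := exists_omega_eq_posPow s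
  exact hn ▸ posPow_mem hs n

theorem exists_mem_mul_eq_omega {U : Subsemigroup S} {s : S} (hs : s ∈ U) :
    ∃ t ∈ U, t * s = omega s ∧ s * t = omega s := by
  obtain ⟨n, hn⟩ := exists_omega_eq_posPow s
  cases n with
  | zero =>
    have hss : s * s = omega s := by
      simpa only [hn, posPow] using (isIdempotentElem_omega s).eq
    exact ⟨s, hs, hss, hss⟩
  | succ n => exact ⟨posPow s n, posPow_mem hs n, hn.symm, by rw [hn, posPow_succ']⟩

theorem omega_smul_eq_self {X : Type*} [SemigroupAction S X] {s : S} {x : X} (h : s • x = x) :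
    omega s • x = x := by
  obtain ⟨n, hn⟩ := exists_omega_eq_posPow s
  rw [hn, posPow_smul_eq_self h]

theorem omega_mul_eq_self_of_mul_mul_eq_self {a b x : S} (h : a * x * b = x) :
    omega a * x = x := by
  obtain ⟨n, hn⟩ := exists_omega_eq_posPow a
  have hx : omega a * x * posPow b n = x := hn ▸ posPow_mul_mul_posPow_eq_self h n
  calc omega a * x = omega a * omega a * x * posPow b n := by
        conv_lhs => rw [← hx]
        simp only [mul_assoc]
    _ = x := by rw [(isIdempotentElem_omega a).eq, hx]

theorem mul_omega_eq_self_of_mul_mul_eq_self {a b x : S} (h : a * x * b = x) :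
    x * omega b = x := by
  obtain ⟨n, hn⟩ := exists_omega_eq_posPow b
  have hx : posPow a n * x * omega b = x := hn ▸ posPow_mul_mul_posPow_eq_self h n
  calc x * omega b = posPow a n * x * (omega b * omega b) := by
        conv_lhs => rw [← hx]
        simp only [mul_assoc]
    _ = x := by rw [(isIdempotentElem_omega b).eq, hx]

end Omega

section PrincipalIdeal

variable {S T : Type u} [Semigroup S] [Semigroup T] {x y : S}

/-- The two-sided ideal `S¹ y S¹` generated by an element `y` of a semigroup `S`, bundled as a
subsemigroup. The inclusion order of these ideals is Green's `𝓙`-order. -/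
def principalIdeal (y : S) : Subsemigroup S where
  carrier := {x | ∃ a b : WithOne S, (x : WithOne S) = a * y * b}
  mul_mem' := by
    rintro _ _ ⟨a, b, hx⟩ ⟨c, d, hx'⟩
    exact ⟨a, b * (c * y * d), by rw [WithOne.coe_mul, hx, hx']; simp only [mul_assoc]⟩

theorem mem_principalIdeal_self (x : S) : x ∈ principalIdeal x := ⟨1, 1, by simp⟩

theorem principalIdeal_le_iff : principalIdeal x ≤ principalIdeal y ↔ x ∈ principalIdeal y := by
  refine ⟨fun h => h (mem_principalIdeal_self x), ?_⟩
  rintro ⟨a, b, hx⟩ z ⟨c, d, hz⟩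
  exact ⟨c * a, b * d, by rw [hz, hx]; simp only [mul_assoc]⟩

theorem principalIdeal_mul_le_left (x y : S) : principalIdeal (x * y) ≤ principalIdeal x :=
  principalIdeal_le_iff.2 ⟨1, y, by rw [WithOne.coe_mul, one_mul]⟩

theorem principalIdeal_mul_le_right (x y : S) : principalIdeal (x * y) ≤ principalIdeal y :=
  principalIdeal_le_iff.2 ⟨x, 1, by rw [WithOne.coe_mul, mul_one]⟩

theorem map_mem_principalIdeal (φ : S →ₙ* T) (h : x ∈ principalIdeal y) :
    φ x ∈ principalIdeal (φ y) := by
  obtain ⟨a, b, hx⟩ := h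
  refine ⟨WithOne.mapMulHom φ a, WithOne.mapMulHom φ b, ?_⟩
  simpa only [map_mul, WithOne.mapMulHom_coe] using congrArg (WithOne.mapMulHom φ) hx

end PrincipalIdeal

section Stability

variable {S : Type u} [Semigroup S] [Finite S] {x c e f i u : S}

instance : Finite (WithOne S) := inferInstanceAs (Finite (Option S))

theorem exists_mul_mul_eq_self_of_mem_principalIdeal (h : x ∈ principalIdeal (c * x)) :
    ∃ t, t * (c * x) = x := by
  obtain ⟨a, b, hx⟩ := h
  have hω : omega (a * c) * (x : WithOne S) = x :=
    omega_mul_eq_self_of_mul_mul_eq_self (b := b)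
      (by simpa only [WithOne.coe_mul, mul_assoc] using hx.symm)
  obtain ⟨t, -, ht, -⟩ := exists_mem_mul_eq_omega (Subsemigroup.mem_top (a * (c : WithOne S)))
  have hta : t * a * ((c * x : S) : WithOne S) = x := by
    rw [← hω, ← ht, WithOne.coe_mul]; simp only [mul_assoc]
  generalize t * a = s at hta
  cases s with
  | one =>
    have hcx : c * x = x := WithOne.coe_inj.1 (by rwa [one_mul] at hta)
    exact ⟨c, by rw [hcx, hcx]⟩
  | coe s => exact ⟨s, WithOne.coe_inj.1 hta⟩

theorem exists_mul_mul_eq_self_of_mem_principalIdeal' (h : x ∈ principalIdeal (x * c)) :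
    ∃ t, x * c * t = x := by
  obtain ⟨a, b, hx⟩ := h
  have hω : (x : WithOne S) * omega (c * b) = x :=
    mul_omega_eq_self_of_mul_mul_eq_self (a := a)
      (by simpa only [WithOne.coe_mul, mul_assoc] using hx.symm)
  obtain ⟨t, -, -, ht⟩ := exists_mem_mul_eq_omega (Subsemigroup.mem_top ((c : WithOne S) * b))
  have hbt : ((x * c : S) : WithOne S) * (b * t) = x := by
    rw [← hω, ← ht, WithOne.coe_mul]; simp only [mul_assoc]
  generalize b * t = s at hbt
  cases s with
  | one =>
    have hxc : x * c = x := WithOne.coe_inj.1 (by rwa [mul_one] at hbt)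
    exact ⟨c, by rw [hxc, hxc]⟩
  | coe s => exact ⟨s, WithOne.coe_inj.1 hbt⟩

theorem mul_eq_self_of_mem_principalIdeal (hi : IsIdempotentElem i) (hie : i * e = i)
    (he : e ∈ principalIdeal i) : e * i = e := by
  obtain ⟨t, ht⟩ := exists_mul_mul_eq_self_of_mem_principalIdeal (c := i) (hie.symm ▸ he)
  rw [hie] at ht
  rw [← ht, mul_assoc, hi.eq]

theorem mul_eq_self_of_mem_principalIdeal' (hi : IsIdempotentElem i) (hfi : f * i = i)
    (hf : f ∈ principalIdeal i) : i * f = f := by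
  obtain ⟨t, ht⟩ := exists_mul_mul_eq_self_of_mem_principalIdeal' (c := i) (hfi.symm ▸ hf)
  rw [hfi] at ht
  rw [← ht, ← mul_assoc, hi.eq]

theorem omega_eq_of_mem_principalIdeal (hiu : i * u = u) (hui : u * i = u)
    (hi : i ∈ principalIdeal u) : omega u = i := by
  obtain ⟨t, ht⟩ := exists_mul_mul_eq_self_of_mem_principalIdeal' (c := u) (hiu.symm ▸ hi)
  have hωi : omega u * i = i :=
    omega_mul_eq_self_of_mul_mul_eq_self (b := t) (by rw [hui, ← hiu, ht])
  obtain ⟨s, -, hs, -⟩ := exists_mem_mul_eq_omega (Subsemigroup.mem_top u)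
  rw [← hωi, ← hs, mul_assoc, hui]

theorem mul_omega_eq_self (he : IsIdempotentElem e) (hf : IsIdempotentElem f)
    (hfu : f * u = u) (hue : u * e = u) (heu : e ∈ principalIdeal u) (hf_u : f ∈ principalIdeal u)
    (hu : u ∈ principalIdeal (omega (f * e))) : e * omega u = e := by
  have hi := isIdempotentElem_omega (f * e)
  obtain ⟨t, -, ht, ht'⟩ := exists_mem_mul_eq_omega (Subsemigroup.mem_top (f * e))
  generalize omega (f * e) = i at *
  have hu_le : principalIdeal u ≤ principalIdeal i := principalIdeal_le_iff.2 hu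
  have hei : e * i = e := mul_eq_self_of_mem_principalIdeal hi
    (by rw [← ht, mul_assoc, mul_assoc, he.eq]) (hu_le heu)
  have hif : i * f = f := mul_eq_self_of_mem_principalIdeal' hi
    (by rw [← ht', ← mul_assoc, ← mul_assoc, hf.eq]) (hu_le hf_u)
  have hiu : i ∈ principalIdeal u := principalIdeal_le_iff.2 hf_u <|
    principalIdeal_mul_le_left f (e * t) <| by
      rw [← mul_assoc, ht']; exact mem_principalIdeal_self i
  rw [omega_eq_of_mem_principalIdeal (by rw [← hfu, ← mul_assoc, hif])
    (by rw [← hue, mul_assoc, hei]) hiu, hei]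

end Stability

section Iteration

instance {S : Type*} [Semigroup S] : SemigroupAction S S where
  mul_smul := mul_assoc

instance {S : Type*} [Semigroup S] : SemigroupAction Sᵐᵒᵖ S where
  mul_smul s t x := (mul_assoc x t.unop s.unop).symm

theorem exists_rel_and_rel_self {α : Type*} [Finite α] {r : α → α → Prop} [IsTrans α r]
    (h : ∀ a, ∃ b, r a b) (a : α) : ∃ b, r a b ∧ r b b := by
  choose next hnext using h
  have hlt ⦃m n : ℕ⦄ : m < n → r (next^[m] a) (next^[n] a) :=
    fun hmn => Nat.rel_of_forall_rel_succ_of_lt r (f := fun n => next^[n] a)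
      (fun n => by simpa only [Function.iterate_succ_apply'] using hnext _) hmn
  obtain ⟨m, n, hmn, heq⟩ := Set.finite_univ.exists_lt_map_eq_of_forall_mem
    (f := fun n => next^[n] a) fun _ => Set.mem_univ _
  refine ⟨next^[n] a, hlt (m := 0) (by omega), ?_⟩
  simpa only [heq] using hlt hmn

theorem exists_isIdempotentElem_smul_eq_self {S : Type u} {X : Type*} [Semigroup S] [Finite S]
    [SemigroupAction S X] {U : Subsemigroup S} {A : Set X} (hA : A.Finite)
    (h : ∀ a ∈ A, ∃ s ∈ U, ∃ b ∈ A, s • b = a) {a : X} (ha : a ∈ A) :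
    ∃ s ∈ U, ∃ b ∈ A, s • b = a ∧ ∃ e ∈ U, IsIdempotentElem e ∧ e • b = b := by
  have := hA.to_subtype
  let r (a b : A) : Prop := ∃ s ∈ U, s • (b : X) = a
  have : IsTrans A r := ⟨by
    rintro a b c ⟨s, hs, hab⟩ ⟨t, ht, hbc⟩
    exact ⟨s * t, mul_mem hs ht, by rw [mul_smul, hbc, hab]⟩⟩
  obtain ⟨⟨b, hb⟩, ⟨s, hs, hsb⟩, w, hw, hwb⟩ := exists_rel_and_rel_self (r := r)
    (fun a => by
      obtain ⟨s, hs, b, hb, hsb⟩ := h a a.2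
      exact ⟨⟨b, hb⟩, s, hs, hsb⟩) ⟨a, ha⟩
  exact ⟨s, hs, b, hb, hsb, omega w, omega_mem hw, isIdempotentElem_omega w,
    omega_smul_eq_self hwb⟩

end Iteration

section Dominion

variable {T : Type u} [Semigroup T] {U : Subsemigroup T} {d : T}

theorem commute_of_mem_dominion (hd : d ∈ dominion U) {W : Type u} [Monoid W] (ψ : T →ₙ* W)
    (w : Wˣ) (hw : ∀ s ∈ U, Commute (w : W) (ψ s)) : Commute (w : W) (ψ d) := by
  let ψw : T →ₙ* W :=
    { toFun t := w * ψ t * ↑w⁻¹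
      map_mul' s t := by simp [mul_assoc] }
  have hψw : ψw d = ψ d :=
    hd W ψw ψ fun s hs => by simp [ψw, (hw s hs).eq]
  rw [Commute, SemiconjBy, ← Units.mul_inv_eq_iff_eq_mul]
  exact hψw

theorem op_mem_dominion_op (hd : d ∈ dominion U) : MulOpposite.op d ∈ dominion U.op := by
  intro W _ α β h
  let unop (γ : Tᵐᵒᵖ →ₙ* W) : T →ₙ* Wᵐᵒᵖ :=
    { toFun t := MulOpposite.op (γ (MulOpposite.op t))
      map_mul' s t := by simp }
  exact MulOpposite.op_injective <|
    hd Wᵐᵒᵖ (unop α) (unop β) fun s hs => congrArg MulOpposite.op (h _ hs)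

/-- The action of `T` on `T¹ × 𝒫(T¹)` by left multiplication on the first component and by
preimages under right multiplication on the second. Its permutations `(b, A) ↦ (b, A ∆ {a | P a b})`
turn statements about commuting maps into statements about relations `P` on `T¹`. -/
def translationEnd (T : Type u) [Semigroup T] :
    T →ₙ* Function.End (WithOne T × Set (WithOne T)) where
  toFun t p := (t * p.1, {a | a * t ∈ p.2})
  map_mul' s t := by
    funext p
    change _ = ((s : WithOne T) * (t * p.1), {a : WithOne T | a * s * t ∈ p.2})
    simp only [WithOne.coe_mul, mul_assoc]

theorem translationEnd_apply (t : T) (p : WithOne T × Set (WithOne T)) :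
    translationEnd T t p = ((t : WithOne T) * p.1, {a | a * (t : WithOne T) ∈ p.2}) := rfl

theorem rel_iff_of_mem_dominion (hd : d ∈ dominion U) {P : WithOne T → WithOne T → Prop}
    (hP : ∀ s ∈ U, ∀ a b, P (a * s) b ↔ P a (s * b)) : P d 1 ↔ P 1 d := by
  let twist (p : WithOne T × Set (WithOne T)) : WithOne T × Set (WithOne T) :=
    (p.1, symmDiff p.2 {a | P a p.1})
  have htwist : Function.Involutive twist := fun p => by simp [twist]
  have hcomm : Commute _ (translationEnd T d) := commute_of_mem_dominion hd (translationEnd T)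
    (Equiv.Perm.equivUnitsEnd htwist.toPerm) fun s hs => by
      funext p
      change twist (translationEnd T s p) = translationEnd T s (twist p)
      refine Prod.ext rfl (Set.ext fun a => ?_)
      simp [twist, translationEnd_apply, Set.mem_symmDiff, hP s hs]
  have h : twist (translationEnd T d (1, ∅)) = translationEnd T d (twist (1, ∅)) :=
    congrFun hcomm.eq (1, ∅)
  have h₁ := Set.ext_iff.1 (congrArg Prod.snd h) 1
  simpa [twist, translationEnd_apply, Set.mem_symmDiff] using h₁.symm

/-- The monoid `U¹`, as a submonoid of `T¹`. -/
def adjoinOne (U : Subsemigroup T) : Submonoid (WithOne T) :=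
  MonoidHom.mrange (WithOne.mapMulHom (MulMemClass.subtype U))

theorem coe_mem_adjoinOne : (d : WithOne T) ∈ adjoinOne U ↔ d ∈ U := by
  constructor
  · rintro ⟨a, ha⟩
    cases a with
    | one => exact absurd ha.symm WithOne.coe_ne_one
    | coe s => exact WithOne.coe_inj.1 ha ▸ s.2
  · exact fun hd => ⟨(⟨d, hd⟩ : U), rfl⟩

theorem exists_factorization_right (hd : d ∈ dominion U) (hdU : d ∉ U) :
    ∃ x ∉ U, ∃ u ∈ U, ∃ y ∉ U, x * u * y = d ∧ u * y ∈ U := by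
  by_contra! hcon
  have hiff := rel_iff_of_mem_dominion hd
    (P := fun a b => a * b = (d : WithOne T) ∧ b ∈ adjoinOne U) fun u hu a b => by
      rw [mul_assoc]
      refine and_congr_right fun hab => ⟨mul_mem (coe_mem_adjoinOne.2 hu), fun hub => ?_⟩
      by_contra hb
      cases b with
      | one => exact hb (one_mem _)
      | coe y =>
        have huy : u * y ∈ U := coe_mem_adjoinOne.1 hub
        cases a with
        | one =>
          rw [one_mul, ← WithOne.coe_mul, WithOne.coe_inj] at hab
          exact hdU (hab ▸ huy)
        | coe x =>
          rw [← WithOne.coe_mul, ← WithOne.coe_mul, WithOne.coe_inj] at hab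
          refine hcon x (fun hx => hdU (hab ▸ mul_mem hx huy)) u hu y
            (fun hy => hb (coe_mem_adjoinOne.2 hy)) (by rw [mul_assoc, hab]) huy
  exact hdU (coe_mem_adjoinOne.1 (hiff.1 ⟨mul_one _, one_mem _⟩).2)

theorem exists_factorization_left (hd : d ∈ dominion U) (hdU : d ∉ U) :
    ∃ x ∉ U, ∃ u ∈ U, ∃ y ∉ U, x * u * y = d ∧ x * u ∈ U := by
  obtain ⟨y, hy, u, hu, x, hx, hyux, hux⟩ :=
    exists_factorization_right (op_mem_dominion_op hd) (mt Subsemigroup.mem_op.1 hdU)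
  exact ⟨x.unop, hx, u.unop, hu, y.unop, hy,
    by rw [mul_assoc]; exact congrArg MulOpposite.unop hyux, hux⟩

end Dominion

section Main

variable {T : Type u} [Semigroup T] {U : Subsemigroup T} {a b d : T}

/-- The part of the `𝓙`-class of `d` that lies outside `U`. -/
def jClassOutside (U : Subsemigroup T) (d : T) : Set T :=
  {a | a ∉ U ∧ principalIdeal a = principalIdeal d}

theorem mem_jClassOutside_of_le (hd : MaximalFor (· ∉ U) principalIdeal d) (hb : b ∉ U)
    (hdb : principalIdeal d ≤ principalIdeal b) : b ∈ jClassOutside U d :=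
  ⟨hb, (hd.2 hb hdb).antisymm hdb⟩

theorem exists_mul_eq_of_mem_jClassOutside (hU : dominion U = Set.univ)
    (hd : MaximalFor (· ∉ U) principalIdeal d) (ha : a ∈ jClassOutside U d) :
    ∃ s ∈ U ⊓ principalIdeal d, ∃ b ∈ jClassOutside U d, s * b = a := by
  obtain ⟨x, hx, u, -, y, hy, rfl, hxu⟩ := exists_factorization_left (hU ▸ Set.mem_univ a) ha.1
  have hx' : x ∈ jClassOutside U d := mem_jClassOutside_of_le hd hx <| ha.2.ge.trans <|
    (principalIdeal_mul_le_left _ _).trans (principalIdeal_mul_le_left _ _)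
  have hxu_mem : x * u ∈ principalIdeal d :=
    hx'.2 ▸ principalIdeal_mul_le_left x u (mem_principalIdeal_self _)
  exact ⟨x * u, ⟨hxu, hxu_mem⟩, y, mem_jClassOutside_of_le hd hy <| ha.2.ge.trans <|
    principalIdeal_mul_le_right _ _, rfl⟩

theorem exists_mul_eq_of_mem_jClassOutside' (hU : dominion U = Set.univ)
    (hd : MaximalFor (· ∉ U) principalIdeal d) (ha : a ∈ jClassOutside U d) :
    ∃ s ∈ U ⊓ principalIdeal d, ∃ b ∈ jClassOutside U d, b * s = a := by
  obtain ⟨x, hx, u, -, y, hy, rfl, huy⟩ := exists_factorization_right (hU ▸ Set.mem_univ a) ha.1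
  have hy' : y ∈ jClassOutside U d := mem_jClassOutside_of_le hd hy <| ha.2.ge.trans <|
    principalIdeal_mul_le_right _ _
  have huy_mem : u * y ∈ principalIdeal d :=
    hy'.2 ▸ principalIdeal_mul_le_right u y (mem_principalIdeal_self _)
  exact ⟨u * y, ⟨huy, huy_mem⟩, x, mem_jClassOutside_of_le hd hx <| ha.2.ge.trans <|
    (principalIdeal_mul_le_left _ _).trans (principalIdeal_mul_le_left _ _),
    (mul_assoc _ _ _).symm⟩

variable [Finite T]

theorem exists_mul_eq_and_isIdempotentElem_mul_eq (hU : dominion U = Set.univ)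
    (hd : MaximalFor (· ∉ U) principalIdeal d) (ha : a ∈ jClassOutside U d) :
    ∃ s ∈ U, ∃ b ∉ U, s * b = a ∧
      ∃ e ∈ U, IsIdempotentElem e ∧ e ∈ principalIdeal d ∧ e * b = b := by
  obtain ⟨s, hs, b, hb, hsb, e, he, hee, heb⟩ := exists_isIdempotentElem_smul_eq_self
    (U := U ⊓ principalIdeal d) (Set.toFinite _)
    (fun a ha => exists_mul_eq_of_mem_jClassOutside hU hd ha) ha
  exact ⟨s, hs.1, b, hb.1, hsb, e, he.1, hee, he.2, heb⟩

theorem exists_mul_eq_and_isIdempotentElem_mul_eq' (hU : dominion U = Set.univ)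
    (hd : MaximalFor (· ∉ U) principalIdeal d) (ha : a ∈ jClassOutside U d) :
    ∃ s ∈ U, ∃ b ∉ U, b * s = a ∧
      ∃ f ∈ U, IsIdempotentElem f ∧ f ∈ principalIdeal d ∧ b * f = b := by
  have : Finite Tᵐᵒᵖ := .of_equiv T MulOpposite.opEquiv
  obtain ⟨s, hs, b, hb, hbs, f, hf, hff, hbf⟩ := exists_isIdempotentElem_smul_eq_self
    (S := Tᵐᵒᵖ) (X := T) (U := (U ⊓ principalIdeal d).op) (Set.toFinite _)
    (fun a ha => by
      obtain ⟨s, hs, b, hb, hbs⟩ := exists_mul_eq_of_mem_jClassOutside' hU hd ha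
      exact ⟨MulOpposite.op s, hs, b, hb, hbs⟩) ha
  exact ⟨s.unop, hs.1, b, hb.1, hbs, f.unop, hf.1, congrArg MulOpposite.unop hff, hf.2, hbf⟩

theorem exists_mul_mul_eq_and_isIdempotentElem (hU : dominion U = Set.univ)
    (hd : MaximalFor (· ∉ U) principalIdeal d) :
    ∃ x, ∃ v ∈ U, ∃ y ∉ U, x * v * y = d ∧ v * y ∈ U ∧
      (∃ f ∈ U, IsIdempotentElem f ∧ f ∈ principalIdeal d ∧ x * f = x) ∧
      ∃ e ∈ U, IsIdempotentElem e ∧ e ∈ principalIdeal d ∧ e * y = y := by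
  obtain ⟨x₀, hx₀, u, hu, y₀, hy₀, hxuy, huy⟩ :=
    exists_factorization_right (hU ▸ Set.mem_univ d) hd.1
  have hx₀_le : principalIdeal d ≤ principalIdeal x₀ := hxuy ▸
    (principalIdeal_mul_le_left _ _).trans (principalIdeal_mul_le_left _ _)
  have hy₀_le : principalIdeal d ≤ principalIdeal y₀ := hxuy ▸ principalIdeal_mul_le_right _ _
  obtain ⟨t, ht, x, -, rfl, hx⟩ := exists_mul_eq_and_isIdempotentElem_mul_eq' hU hd
    (mem_jClassOutside_of_le hd hx₀ hx₀_le)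
  obtain ⟨s, hs, y, hy, rfl, hy'⟩ := exists_mul_eq_and_isIdempotentElem_mul_eq hU hd
    (mem_jClassOutside_of_le hd hy₀ hy₀_le)
  refine ⟨x, t * u * s, mul_mem (mul_mem ht hu) hs, y, hy, ?_, ?_, hx, hy'⟩
  · rw [← hxuy]; simp only [mul_assoc]
  · simpa only [mul_assoc] using mul_mem ht huy

theorem eq_top_of_dominion_eq_univ (hU : dominion U = Set.univ)
    (hlaw : ∀ t ∈ U, ∀ x ∈ U, ∀ z ∈ U,
      omega t * x * omega z ∈ principalIdeal (omega (omega t * omega z))) : U = ⊤ := by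
  by_contra hne
  obtain ⟨d₀, hd₀⟩ : ∃ d, d ∉ U := by
    by_contra! hmem
    exact hne ((Subsemigroup.eq_top_iff' U).2 hmem)
  obtain ⟨d, hd⟩ := (Set.toFinite {d | d ∉ U}).exists_maximalFor principalIdeal _ ⟨d₀, hd₀⟩
  obtain ⟨x, v, hv, y, hy, hxvy, hvy, ⟨f, hf, hff, hfd, hxf⟩, e, he, hee, hed, hey⟩ :=
    exists_mul_mul_eq_and_isIdempotentElem hU hd
  obtain ⟨u, hu⟩ : ∃ u, f * v * e = u := ⟨_, rfl⟩
  have huU : u ∈ U := hu ▸ mul_mem (mul_mem hf hv) he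
  have hd_eq : d = x * u * y := by
    rw [← hxvy, ← hu]
    conv_lhs => rw [← hxf, ← hey]
    simp only [mul_assoc]
  have hd_le : principalIdeal d ≤ principalIdeal u := hd_eq ▸
    (principalIdeal_mul_le_left _ _).trans (principalIdeal_mul_le_right _ _)
  have heu : e * omega u = e := mul_omega_eq_self hee hff
    (by rw [← hu, ← mul_assoc, ← mul_assoc, hff.eq]) (by rw [← hu, mul_assoc, hee.eq])
    (hd_le hed) (hd_le hfd)
    (by simpa only [omega_eq_self hff, omega_eq_self hee, hu] using hlaw f hf v hv e he)
  have huy : u * y ∈ U := by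
    rw [← hu, mul_assoc, mul_assoc, hey]
    exact mul_mem hf hvy
  obtain ⟨w, hw, hwu, -⟩ := exists_mem_mul_eq_omega huU
  have hy_eq : e * (w * (u * y)) = y := by rw [← mul_assoc w, hwu, ← mul_assoc, heu, hey]
  exact hy (hy_eq ▸ mul_mem he (mul_mem hw huy))

end Main

section Classes

open CategoryTheory

/-- The finite semigroups in which `e x f` lies in the ideal generated by `(e f)^ω`, where
`e = t^ω`, `f = z^ω`: a common generalization of `V₂` and `V₃`. -/
def VJ : ObjectProperty Semigrp.{u} := fun S =>
  ∃ _ : Finite S, ∀ t x z : S,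
    omega t * x * omega z ∈ principalIdeal (omega (omega t * omega z))

theorem V₂_le_VJ : V₂.{u} ≤ VJ := by
  rintro S ⟨hS, hlaw⟩
  refine ⟨hS, fun t x z => ?_⟩
  rw [← hlaw t x z]
  exact principalIdeal_mul_le_right _ _ (mem_principalIdeal_self _)

theorem V₃_le_VJ : V₃.{u} ≤ VJ := by
  rintro S ⟨hS, hlaw⟩
  refine ⟨hS, fun t x z => ?_⟩
  rw [← hlaw t x z, mul_assoc, mul_assoc]
  exact principalIdeal_mul_le_left _ _ (mem_principalIdeal_self _)

theorem V₂_of_surjective {S T : Semigrp.{u}} (φ : S →ₙ* T) (hφ : Function.Surjective φ)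
    (hS : V₂ S) : V₂ T := by
  obtain ⟨_, hlaw⟩ := hS
  have hT := Finite.of_surjective φ hφ
  refine ⟨hT, hφ.forall₃.2 fun t x z => ?_⟩
  simpa only [map_mul, map_omega] using congrArg φ (hlaw t x z)

theorem V₃_of_surjective {S T : Semigrp.{u}} (φ : S →ₙ* T) (hφ : Function.Surjective φ)
    (hS : V₃ S) : V₃ T := by
  obtain ⟨_, hlaw⟩ := hS
  have hT := Finite.of_surjective φ hφ
  refine ⟨hT, hφ.forall₃.2 fun t x z => ?_⟩
  simpa only [map_mul, map_omega] using congrArg φ (hlaw t x z)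

theorem surjective_of_dominion_srange_eq_univ {S : Semigrp.{u}} (hS : VJ S) {T : Type u}
    [Semigroup T] [Finite T] (φ : S →ₙ* T) (hφ : dominion φ.srange = Set.univ) :
    Function.Surjective φ := by
  obtain ⟨_, hlaw⟩ := hS
  refine MulHom.srange_eq_top_iff_surjective.1 (eq_top_of_dominion_eq_univ hφ ?_)
  rintro _ ⟨t, rfl⟩ _ ⟨x, rfl⟩ _ ⟨z, rfl⟩
  simpa only [map_mul, map_omega] using map_mem_principalIdeal φ (hlaw t x z)

theorem dominion_srange_eq_univ_of_epi {S T : Semigrp.{u}} (φ : S ⟶ T) [Epi φ] :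
    dominion φ.hom.srange = Set.univ := by
  refine Set.eq_univ_of_forall fun d W _ α β h => ?_
  have hαβ : Semigrp.ofHom α = Semigrp.ofHom β := by
    rw [← cancel_epi φ]
    ext s
    exact h _ ⟨s, rfl⟩
  exact congrArg (fun ψ : T ⟶ Semigrp.of W => ψ.hom d) hαβ

end Classes

end FSat

theorem corollaryc_general {C : CategoryTheory.ObjectProperty Semigrp.{u}} (hC : C ≤ FSat.VJ)
    (hC_surj : ∀ {S T : Semigrp.{u}} (φ : S →ₙ* T), Function.Surjective φ → C S → C T) :
    FSat.FSaturatedClass C ∧ FSat.FEpiClosed C := by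
  constructor
  · intro S hS T _ _ ι _ hι hdom
    exact hι (FSat.surjective_of_dominion_srange_eq_univ (hC S hS) ι hdom)
  · intro S T φ _ _ hS
    exact hC_surj φ.hom (FSat.surjective_of_dominion_srange_eq_univ (hC S hS) φ.hom
      (FSat.dominion_srange_eq_univ_of_epi φ)) hS

theorem corollaryc :
    (FSat.FSaturatedClass FSat.V₂.{u} ∧ FSat.FEpiClosed FSat.V₂.{u}) ∧
      (FSat.FSaturatedClass FSat.V₃.{u} ∧ FSat.FEpiClosed FSat.V₃.{u}) :=
  ⟨corollaryc_general FSat.V₂_le_VJ FSat.V₂_of_surjective,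
    corollaryc_general FSat.V₃_le_VJ FSat.V₃_of_surjective⟩
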